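/- For $X\subseteq\mathbb{R}^d$ and $\sigma>0$ let $H_\sigma(X)$ be the reproducing kernel Hilbert space of the Gaussian kernel $k_\sigma(x,x')=\exp(-\sigma^2\|x-x'\|_2^2)$, $x,x'\in X$, let $\ell_\infty(X)$ be the space of bounded functions $X\to\mathbb{R}$ with the supremum norm, and let $B_2^d$ be the closed Euclidean unit ball of $\mathbb{R}^d$. For a bounded linear operator $T:E\to F$ between Banach spaces and $\varepsilon>0$, let $\mathcal{H}(\varepsilon,T)=\log N$, where $N$ is the least number of closed balls of radius $\varepsilon$ in $F$ (with arbitrary centres in $F$) that cover the image under $T$ of the closed unit ball of $E$. For $t>0$ and $k\in\mathbb{N}$ let $\binom{t}{k}=\frac{1}{k!}\prod_{i=1}^k(t-k+i)$. Then for all integers $d\ge 1$, all $\sigma>0$ and all $0<\varepsilon\le 1$, the covering number in question is finite and $$\mathcal{H}\bigl(\varepsilon,\ \mathrm{Id}:H_\sigma(B_2^d)\to\ell_\infty(B_2^d)\bigr)\ \le\ \binom{2e(1+\sigma^2)+d}{d}\cdot e^{-d}\cdot\frac{\bigl(\log(4/\varepsilon)\bigr)^{d+1}}{\bigl(\log\log(4/\varepsilon)\bigr)^{d}},$$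 where $\log$ is the natural logarithm. -/

import Mathlib

open MeasureTheory ProbabilityTheory
open scoped ENNReal

/-- The isotropic Gaussian kernel `k_σ(x, y) = exp (-σ² ‖x - y‖²)` on `X ⊆ ℝᵈ`. Mathlib's kernels are
operator valued: the real number `k_σ(x, y)` is read as the multiplication `v ↦ k_σ(x, y) * v`. -/
noncomputable def gaussianKernel {d : ℕ} (σ : ℝ) (X : Set (EuclideanSpace ℝ (Fin d))) :
    Matrix X X (ℝ →L[ℝ] ℝ) :=
  Matrix.of fun x y =>
    Real.exp (-σ ^ 2 * ‖(x : EuclideanSpace ℝ (Fin d)) - y‖ ^ 2) • ContinuousLinearMap.id ℝ ℝ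

/-- The Gaussian kernel as an average of cosines. -/
theorem exp_neg_sq_eq_integral_cos {d : ℕ} (σ : ℝ) (z : EuclideanSpace ℝ (Fin d)) :
    Real.exp (-σ ^ 2 * ‖z‖ ^ 2) =
      ∫ w, Real.cos (√2 * σ * inner ℝ w z) ∂(stdGaussian (EuclideanSpace ℝ (Fin d))) := by
  have h := charFun_stdGaussian (E := EuclideanSpace ℝ (Fin d)) ((√2 * σ) • z)
  rw [charFun_apply] at h
  have hi : Integrable (fun w : EuclideanSpace ℝ (Fin d) =>
      Complex.exp (inner ℝ w ((√2 * σ) • z) * Complex.I))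
      (stdGaussian (EuclideanSpace ℝ (Fin d))) := by
    refine Integrable.of_bound (C := 1) (by fun_prop) (Filter.Eventually.of_forall fun w => ?_)
    rw [Complex.norm_exp_ofReal_mul_I]
  have h2 := congrArg Complex.re h
  have h3 : ((-((‖(√2 * σ) • z‖ : ℝ) : ℂ) ^ 2 / 2) : ℂ) = ((-σ ^ 2 * ‖z‖ ^ 2 : ℝ) : ℂ) := by
    rw [norm_smul, Real.norm_eq_abs, ← Complex.ofReal_pow, mul_pow, sq_abs, mul_pow,
      Real.sq_sqrt (by norm_num : (0 : ℝ) ≤ 2)]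
    push_cast
    ring
  rw [h3, ← Complex.ofReal_exp, Complex.ofReal_re] at h2
  simp only [inner_smul_right] at h2
  have h4 := integral_re hi
  simp only [RCLike.re_to_complex, Complex.exp_ofReal_mul_I_re, inner_smul_right] at h4
  rw [← h2, ← h4]

/-- The Gaussian kernel is positive semidefinite. -/
theorem gaussianKernel_posSemidef {d : ℕ} (σ : ℝ) (X : Set (EuclideanSpace ℝ (Fin d))) :
    (gaussianKernel σ X).PosSemidef := by
  have htfae := (RKHS.posSemidef_tfae (K := gaussianKernel σ X)).out 0 2
  refine htfae.2 ⟨?_, fun v => ?_⟩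
  · ext x y
    simp only [gaussianKernel, Matrix.conjTranspose_apply, Matrix.of_apply, star_smul, star_trivial,
      norm_sub_rev (y : EuclideanSpace ℝ (Fin d)), ← ContinuousLinearMap.one_def, star_one]
  · have hc : ∀ z : EuclideanSpace ℝ (Fin d), Integrable (fun w =>
        Real.cos (√2 * σ * inner ℝ w z)) (stdGaussian (EuclideanSpace ℝ (Fin d))) := fun z =>
      Integrable.of_bound (C := 1) (by fun_prop)
        (Filter.Eventually.of_forall fun w => Real.abs_cos_le_one _)
    have key : (v.sum fun x a => v.sum fun y b => inner ℝ (gaussianKernel σ X y x a) b) =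
        ∫ w, ((∑ x ∈ v.support, v x * Real.cos (√2 * σ * inner ℝ w (x : EuclideanSpace ℝ (Fin d)))) ^ 2
          + (∑ x ∈ v.support, v x * Real.sin (√2 * σ * inner ℝ w (x : EuclideanSpace ℝ (Fin d)))) ^ 2)
          ∂(stdGaussian (EuclideanSpace ℝ (Fin d))) := by
      have h1 : ∀ w : EuclideanSpace ℝ (Fin d),
          ((∑ x ∈ v.support, v x * Real.cos (√2 * σ * inner ℝ w (x : EuclideanSpace ℝ (Fin d)))) ^ 2
          + (∑ x ∈ v.support, v x * Real.sin (√2 * σ * inner ℝ w (x : EuclideanSpace ℝ (Fin d)))) ^ 2)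
          = ∑ x ∈ v.support, ∑ y ∈ v.support, v x * v y *
            Real.cos (√2 * σ * inner ℝ w ((y : EuclideanSpace ℝ (Fin d)) - x)) := by
        intro w
        rw [sq, sq, Finset.sum_mul_sum, Finset.sum_mul_sum, ← Finset.sum_add_distrib]
        refine Finset.sum_congr rfl fun x _ => ?_
        rw [← Finset.sum_add_distrib]
        refine Finset.sum_congr rfl fun y _ => ?_
        rw [inner_sub_right, mul_sub, Real.cos_sub]
        ring
      simp_rw [h1]
      rw [integral_finsetSum _ fun x _ => integrable_finsetSum _ fun y _ => (hc _).const_mul _]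
      refine Finset.sum_congr rfl fun x _ => ?_
      rw [integral_finsetSum _ fun y _ => (hc _).const_mul _]
      refine Finset.sum_congr rfl fun y _ => ?_
      rw [integral_const_mul, ← exp_neg_sq_eq_integral_cos]
      simp [gaussianKernel]
      ring
    rw [key]
    exact integral_nonneg fun w => add_nonneg (sq_nonneg _) (sq_nonneg _)

instance gaussianKernel_fact {d : ℕ} (σ : ℝ) (X : Set (EuclideanSpace ℝ (Fin d))) :
    Fact (gaussianKernel σ X).PosSemidef :=
  ⟨gaussianKernel_posSemidef σ X⟩

/-- The Gaussian RKHS `H_σ(X)`: the reproducing kernel Hilbert space of functions `X → ℝ` whose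
kernel is the Gaussian kernel. -/
abbrev GaussianRKHS {d : ℕ} (σ : ℝ) (X : Set (EuclideanSpace ℝ (Fin d))) :=
  RKHS.OfKernel (gaussianKernel σ X)

theorem GaussianRKHS.norm_apply_le {d : ℕ} {σ : ℝ} {X : Set (EuclideanSpace ℝ (Fin d))}
    (f : GaussianRKHS σ X) (x : X) : ‖f x‖ ≤ ‖f‖ := by
  have h := RKHS.norm_apply_le f x
  rw [RKHS.OfKernel.kernel_ofKernel] at h
  simpa [gaussianKernel] using h

/-- The canonical embedding `Id : H_σ(X) → ℓ_∞(X)`, `f ↦ (f x)_{x ∈ X}`. -/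
noncomputable def gaussianEmbedding {d : ℕ} (σ : ℝ) (X : Set (EuclideanSpace ℝ (Fin d))) :
    GaussianRKHS σ X →L[ℝ] lp (fun _ : X => ℝ) ∞ :=
  LinearMap.mkContinuous
    { toFun := fun f => ⟨fun x => f x, memℓp_infty
        ⟨‖f‖, by rintro _ ⟨x, rfl⟩; exact GaussianRKHS.norm_apply_le f x⟩⟩
      map_add' := fun f g => by ext x; simp; rfl
      map_smul' := fun c f => by ext x; simp }
    1 fun f => by
      rw [one_mul]
      exact lp.norm_le_of_forall_le (norm_nonneg f) (GaussianRKHS.norm_apply_le f)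

/-- The log-covering number of a bounded operator `T : E → F` at scale `ε > 0`: the natural logarithm
of the least number of closed `ε`-balls in `F`, with arbitrary centres, that cover the image under `T`
of the closed unit ball of `E`. It is `⊤` if no finite number suffices. -/
noncomputable def logCoveringNumber {E F : Type*} [NormedAddCommGroup E] [NormedSpace ℝ E]
    [NormedAddCommGroup F] [NormedSpace ℝ F] (ε : ℝ) (T : E →L[ℝ] F) : EReal :=
  ENNReal.log
    (Metric.externalCoveringNumber ε.toNNReal (T '' Metric.closedBall 0 1) : ℝ≥0∞)

/-! Since `exp (-σ²‖x - y‖²) = exp (-σ²‖x‖²) exp (-σ²‖y‖²) ∑ₖ (2σ²⟪x, y⟫)ᵏ / k!`, weighted monomials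
give a feature map `Φ` into `ℓ²`, and every `f` in the unit ball of the RKHS is `x ↦ ⟪w, Φ x⟫` with
`‖w‖ ≤ 1` (`RKHS.exists_inner_eq_apply`). Dropping the features of degree at least `N` costs at most
the square root of a Poisson tail, because the squares of the degree `k` features sum to the Poisson
weight at `k` with mean `2σ²‖x‖² ≤ 2σ²`.

Put `L = log (4/ε)`, `M = 2(1+σ²)L / log L` and `N = ⌊M⌋ + 1`. A Chernoff bound makes the tail at
most `exp (-2L) = (ε/4)²`. What remains is a nonexpansive image of a Euclidean unit ball of
dimension `(⌊M⌋ + d).choose d`. A volume argument covers it at scale `3ε/4` with log-cardinality at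
most the dimension times `L`, and the binomial coefficient is then compared with the claimed one
factor by factor. -/

/-! ### Covering finite-dimensional unit balls -/

open Module Metric in
/-- Volume bound for the cardinality of a separated subset of the unit ball. -/
theorem card_le_of_separated_of_norm_le_one {E : Type*} [NormedAddCommGroup E] [NormedSpace ℝ E]
    [FiniteDimensional ℝ E] {η : ℝ} (hη : 0 < η) (s : Finset E) (hs : ∀ c ∈ s, ‖c‖ ≤ 1)
    (h : ∀ c ∈ s, ∀ c' ∈ s, c ≠ c' → η ≤ ‖c - c'‖) :
    (s.card : ℝ) ≤ (1 + 2 / η) ^ finrank ℝ E := by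
  borelize E
  let μ : Measure E := Measure.addHaar
  have hη2 : 0 < η / 2 := by positivity
  have hρ : 0 < 1 + η / 2 := by positivity
  -- Disjoint balls of radius `η/2` all lie in the ball of radius `1 + η/2`; comparing volumes
  -- bounds their number.
  have hdisj : Set.Pairwise (s : Set E) (Function.onFun Disjoint fun c => ball (c : E) (η / 2)) := by
    intro c hc c' hc' hne
    apply ball_disjoint_ball
    rw [dist_eq_norm]
    linarith [h c hc c' hc' hne]
  have hsub : (⋃ c ∈ s, ball (c : E) (η / 2)) ⊆ ball (0 : E) (1 + η / 2) := by
    refine Set.iUnion₂_subset fun x hx => ball_subset_ball' ?_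
    rw [dist_zero_right]
    linarith [hs x hx]
  have hvol : (s.card : ℝ≥0∞) * ENNReal.ofReal ((η / 2) ^ finrank ℝ E) * μ (ball 0 1) ≤
      ENNReal.ofReal ((1 + η / 2) ^ finrank ℝ E) * μ (ball 0 1) :=
    calc
      _ = μ (⋃ c ∈ s, ball (c : E) (η / 2)) := by
        rw [measure_biUnion_finset hdisj fun c _ => measurableSet_ball]
        simp only [μ.addHaar_ball_of_pos _ hη2, Finset.sum_const, nsmul_eq_mul, mul_assoc]
      _ ≤ μ (ball (0 : E) (1 + η / 2)) := measure_mono hsub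
      _ = _ := by simp only [μ.addHaar_ball_of_pos _ hρ]
  have hcard := (ENNReal.mul_le_mul_iff_left (measure_ball_pos _ _ zero_lt_one).ne'
    measure_ball_lt_top.ne).1 hvol
  have hreal := ENNReal.toReal_le_of_le_ofReal (by positivity) hcard
  rw [ENNReal.toReal_mul, ENNReal.toReal_natCast, ENNReal.toReal_ofReal (by positivity)] at hreal
  have hq : 1 + 2 / η = (1 + η / 2) / (η / 2) := by field_simp; ring
  rw [hq, div_pow]
  exact (le_div_iff₀ (by positivity)).2 hreal

open Module Metric in
/-- The unit ball of an `m`-dimensional space is covered by `(1 + 2 / η) ^ m` balls of radius `η`. -/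
theorem exists_finset_isCover_closedBall {E : Type*} [NormedAddCommGroup E] [NormedSpace ℝ E]
    [FiniteDimensional ℝ E] {η : ℝ} (hη : 0 < η) :
    ∃ s : Finset E, (∀ x : E, ‖x‖ ≤ 1 → ∃ c ∈ s, ‖x - c‖ ≤ η) ∧
      (s.card : ℝ) ≤ (1 + 2 / η) ^ finrank ℝ E := by
  have hsep : ∀ s : Finset E, (s : Set E) ⊆ closedBall 0 1 → IsSeparated η.toNNReal (s : Set E) →
      (s.card : ℝ) ≤ (1 + 2 / η) ^ finrank ℝ E := fun s hs hsep => by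
    refine card_le_of_separated_of_norm_le_one hη s (fun c hc => by simpa using hs hc)
      fun c hc c' hc' hne => ?_
    have h : ENNReal.ofReal η < edist c c' := hsep hc hc' hne
    rw [edist_dist, dist_eq_norm] at h
    exact ((ENNReal.ofReal_lt_ofReal_iff_of_nonneg hη.le).1 h).le
  -- An infinite packing number must be excluded before a maximal separated set can serve as a net:
  -- a separated set that is too large would contain a finite one violating the volume bound.
  have hfin : packingNumber η.toNNReal (closedBall (0 : E) 1) ≠ ⊤ := by
    refine ne_top_of_le_ne_top (ENat.natCast_ne_top ⌊(1 + 2 / η) ^ finrank ℝ E⌋₊)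
      (iSup₂_le fun C hC => iSup_le fun hCsep => ?_)
    by_contra! hlt
    obtain ⟨t, htC, htcard⟩ := Set.exists_subset_encard_eq (Order.add_one_le_of_lt hlt)
    have htfin : t.Finite := Set.finite_of_encard_eq_coe (k := ⌊(1 + 2 / η) ^ finrank ℝ E⌋₊ + 1)
      (by rw [htcard]; rfl)
    lift t to Finset E using htfin
    rw [Set.encard_coe_eq_coe_finsetCard] at htcard
    have h1 := hsep t (htC.trans hC) (hCsep.mono htC)
    have h2 : t.card = ⌊(1 + 2 / η) ^ finrank ℝ E⌋₊ + 1 := by exact_mod_cast htcard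
    have h3 := Nat.lt_floor_add_one ((1 + 2 / η) ^ finrank ℝ E)
    rw [h2] at h1
    push_cast at h1
    linarith
  obtain ⟨s, hs⟩ := (Set.encard_ne_top_iff.1 (by rwa [encard_maximalSeparatedSet hfin] :
    (maximalSeparatedSet η.toNNReal (closedBall (0 : E) 1)).encard ≠ ⊤)).exists_finset_coe
  refine ⟨s, fun x hx => ?_, hsep s (hs ▸ maximalSeparatedSet_subset)
    (hs ▸ isSeparated_maximalSeparatedSet)⟩
  obtain ⟨c, hc, hxc⟩ := isCover_maximalSeparatedSet hfin (x := x) (by simpa using hx)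
  refine ⟨c, by rw [← hs] at hc; exact hc, ?_⟩
  have hxc' : edist x c ≤ ENNReal.ofReal η := hxc
  rw [edist_dist, dist_eq_norm] at hxc'
  exact (ENNReal.ofReal_le_ofReal_iff hη.le).1 hxc'

open Module Metric in
/-- If the image of the unit ball under `T` is `δ`-close to the image of the unit ball of an
`m`-dimensional space under a nonexpansive map, then its covering number at scale `δ + η` is at most
`(1 + 2 / η) ^ m`. -/
theorem logCoveringNumber_le_of_approx {E F G : Type*} [NormedAddCommGroup E] [NormedSpace ℝ E]
    [NormedAddCommGroup F] [NormedSpace ℝ F] [NormedAddCommGroup G] [NormedSpace ℝ G]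
    [FiniteDimensional ℝ G] {δ η : ℝ} (hη : 0 < η) (T : E →L[ℝ] F) (A : G → F)
    (hA : ∀ g g', ‖A g - A g'‖ ≤ ‖g - g'‖)
    (hT : ∀ f : E, ‖f‖ ≤ 1 → ∃ g : G, ‖g‖ ≤ 1 ∧ ‖T f - A g‖ ≤ δ) :
    logCoveringNumber (δ + η) T ≤ ((finrank ℝ G * Real.log (1 + 2 / η) : ℝ) : EReal) := by
  classical
  obtain ⟨s, hs, hcard⟩ := exists_finset_isCover_closedBall (E := G) hη
  have hcover : IsCover (δ + η).toNNReal (T '' closedBall 0 1) ((s.image A : Finset F) : Set F) := by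
    rintro _ ⟨f, hf, rfl⟩
    obtain ⟨g, hg, hfg⟩ := hT f (by simpa using hf)
    obtain ⟨c, hc, hgc⟩ := hs g hg
    refine ⟨A c, by simpa using ⟨c, hc, rfl⟩, ?_⟩
    change edist (T f) (A c) ≤ ENNReal.ofReal (δ + η)
    rw [edist_dist, dist_eq_norm]
    refine ENNReal.ofReal_le_ofReal ?_
    calc ‖T f - A c‖ ≤ ‖T f - A g‖ + ‖A g - A c‖ := norm_sub_le_norm_sub_add_norm_sub _ _ _
      _ ≤ δ + η := add_le_add hfg ((hA g c).trans hgc)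
  have h1 : ((externalCoveringNumber (δ + η).toNNReal (T '' closedBall 0 1) : ℕ∞) : ℝ≥0∞) ≤
      ENNReal.ofReal ((1 + 2 / η) ^ finrank ℝ G) := by
    have h2 := hcover.externalCoveringNumber_le_encard
    rw [Set.encard_coe_eq_coe_finsetCard] at h2
    calc _ ≤ (((s.image A).card : ℕ∞) : ℝ≥0∞) := by exact_mod_cast h2
      _ = ENNReal.ofReal ((s.image A).card : ℝ) := by simp
      _ ≤ _ := ENNReal.ofReal_le_ofReal
        (le_trans (by exact_mod_cast Finset.card_image_le) hcard)
  refine (ENNReal.log_monotone h1).trans ?_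
  rw [ENNReal.log_ofReal_of_pos (by positivity), Real.log_pow]

/-! ### The RKHS through an `ℓ²` feature map -/

theorem Real.exp_eq_tsum_pow_div_factorial (x : ℝ) :
    Real.exp x = ∑' n : ℕ, x ^ n / n.factorial := by
  rw [Real.exp_eq_exp_ℝ, NormedSpace.exp_eq_tsum_div]

open RKHS in
/-- A feature map of the kernel represents every function of the RKHS. -/
theorem RKHS.exists_inner_eq_apply {X H G : Type*} [NormedAddCommGroup H] [InnerProductSpace ℝ H]
    [CompleteSpace H] [RKHS ℝ H X ℝ] [NormedAddCommGroup G] [InnerProductSpace ℝ G]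
    [CompleteSpace G] (Φ : X → G) (hΦ : ∀ x y, inner ℝ (Φ x) (Φ y) = kernel H x y 1) (f : H) :
    ∃ w : G, ‖w‖ ≤ ‖f‖ ∧ ∀ x, f x = inner ℝ w (Φ x) := by
  -- Kernel sections and features have the same Gram matrix, so `e c ↦ g c` is isometric on a dense
  -- subspace and extends to `H`; `w` is the image of `f`.
  let e : (X →₀ ℝ) →ₗ[ℝ] H := Finsupp.linearCombination ℝ fun x => kerFun H x 1
  let g : (X →₀ ℝ) →ₗ[ℝ] G := Finsupp.linearCombination ℝ Φ
  have hinner : ∀ x y, inner ℝ (kerFun H x 1) (kerFun H y 1) = inner ℝ (Φ x) (Φ y) := fun x y => by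
    rw [hΦ, kerFun_inner, kerFun_apply]
    simp
  have hnorm : ∀ c, ‖g c‖ ≤ 1 * ‖e c‖ := fun c => by
    have h : inner ℝ (g c) (g c) = inner ℝ (e c) (e c) := by
      simp only [g, e, Finsupp.linearCombination_apply, Finsupp.sum_inner, Finsupp.inner_sum,
        inner_smul_left, inner_smul_right, hinner]
    rw [real_inner_self_eq_norm_sq, real_inner_self_eq_norm_sq] at h
    rw [one_mul]
    exact ((sq_eq_sq₀ (norm_nonneg _) (norm_nonneg _)).1 h).le
  have hdense : DenseRange e := by
    have h := kerFun_dense H (𝕜 := ℝ)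
    have hspan : Submodule.span ℝ {kerFun H x v | (x) (v)} ≤ LinearMap.range e := by
      refine Submodule.span_le.2 ?_
      rintro _ ⟨x, v, rfl⟩
      refine ⟨Finsupp.single x v, ?_⟩
      simp only [e, Finsupp.linearCombination_single, ← map_smul, smul_eq_mul, mul_one]
    exact (Submodule.dense_iff_topologicalClosure_eq_top.2 h).mono hspan
  refine ⟨g.extendOfNorm e f, ?_, fun x => ?_⟩
  · simpa using LinearMap.norm_extendOfNorm_apply_le hdense 1 hnorm f
  · refine hdense.induction_on (p := fun f => f x = inner ℝ (g.extendOfNorm e f) (Φ x)) f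
      (isClosed_eq (continuous_eval x) (by fun_prop)) fun c => ?_
    rw [LinearMap.extendOfNorm_eq hdense ⟨1, hnorm⟩]
    have h : (e c) x = inner ℝ (e c) (kerFun H x 1) := by simp
    rw [h]
    simp only [g, e, Finsupp.linearCombination_apply, Finsupp.sum_inner, inner_smul_left, hinner]

/-- The feature of the Gaussian kernel indexed by a monomial `i.2` of
degree `i.1`. -/
noncomputable def gaussianFeature {d : ℕ} (σ : ℝ) (x : EuclideanSpace ℝ (Fin d))
    (i : Σ k, Sym (Fin d) k) : ℝ :=
  Real.exp (-(σ ^ 2 * ‖x‖ ^ 2)) *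
    (√((2 * σ ^ 2) ^ i.1 / i.1.factorial * (i.2 : Multiset (Fin d)).countPerms) *
      ((i.2 : Multiset (Fin d)).map x).prod)

/-- Multinomial theorem for `⟪x, y⟫ᵏ`, with `countPerms` as the multinomial coefficient. -/
theorem sum_gaussianFeature_mul {d : ℕ} (σ : ℝ) (x y : EuclideanSpace ℝ (Fin d)) (k : ℕ) :
    ∑ m : Sym (Fin d) k, gaussianFeature σ x ⟨k, m⟩ * gaussianFeature σ y ⟨k, m⟩ =
      Real.exp (-(σ ^ 2 * (‖x‖ ^ 2 + ‖y‖ ^ 2))) *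
        ((2 * σ ^ 2 * inner ℝ x y) ^ k / k.factorial) := by
  have hpow : (inner ℝ x y : ℝ) ^ k = ∑ m : Sym (Fin d) k, ((m : Multiset (Fin d)).countPerms : ℝ) *
      (((m : Multiset (Fin d)).map x).prod * ((m : Multiset (Fin d)).map y).prod) := by
    rw [PiLp.inner_apply, Finset.sum_pow, Finset.sym_univ]
    refine Finset.sum_congr rfl fun m _ => ?_
    rw [← Multiset.prod_map_mul]
    simp [mul_comm]
  rw [mul_pow, hpow, Finset.mul_sum, Finset.sum_div, Finset.mul_sum]
  refine Finset.sum_congr rfl fun m _ => ?_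
  have hc : 0 ≤ (2 * σ ^ 2) ^ k / (k.factorial : ℝ) * ((m : Multiset (Fin d)).countPerms : ℝ) := by
    positivity
  have hs := Real.mul_self_sqrt hc
  have he : Real.exp (-(σ ^ 2 * (‖x‖ ^ 2 + ‖y‖ ^ 2))) =
      Real.exp (-(σ ^ 2 * ‖x‖ ^ 2)) * Real.exp (-(σ ^ 2 * ‖y‖ ^ 2)) := by
    rw [← Real.exp_add]; congr 1; ring
  rw [he]
  simp only [gaussianFeature]
  linear_combination (Real.exp (-(σ ^ 2 * ‖x‖ ^ 2)) * Real.exp (-(σ ^ 2 * ‖y‖ ^ 2)) *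
    ((m : Multiset (Fin d)).map x).prod * ((m : Multiset (Fin d)).map y).prod) * hs

theorem sum_gaussianFeature_sq {d : ℕ} (σ : ℝ) (x : EuclideanSpace ℝ (Fin d)) (k : ℕ) :
    ∑ m : Sym (Fin d) k, gaussianFeature σ x ⟨k, m⟩ ^ 2 =
      Real.exp (-(2 * σ ^ 2 * ‖x‖ ^ 2)) * ((2 * σ ^ 2 * ‖x‖ ^ 2) ^ k / k.factorial) := by
  simp_rw [sq (gaussianFeature _ _ _)]
  rw [sum_gaussianFeature_mul, real_inner_self_eq_norm_sq]
  congr 2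
  ring

theorem summable_gaussianFeature_sq {d : ℕ} (σ : ℝ) (x : EuclideanSpace ℝ (Fin d)) :
    Summable fun i => gaussianFeature σ x i ^ 2 := by
  refine (summable_sigma_of_nonneg fun i => sq_nonneg _).2 ⟨fun k => Summable.of_finite, ?_⟩
  simp_rw [tsum_fintype, sum_gaussianFeature_sq]
  exact (Real.summable_pow_div_factorial _).mul_left _

/-- The feature map of the Gaussian kernel into `ℓ²`. -/
noncomputable def gaussianFeatureMap {d : ℕ} (σ : ℝ) (x : EuclideanSpace ℝ (Fin d)) :
    lp (fun _ : Σ k, Sym (Fin d) k => ℝ) 2 :=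
  ⟨gaussianFeature σ x, memℓp_gen (by simpa using summable_gaussianFeature_sq σ x)⟩

theorem inner_gaussianFeatureMap {d : ℕ} (σ : ℝ) (x y : EuclideanSpace ℝ (Fin d)) :
    inner ℝ (gaussianFeatureMap σ x) (gaussianFeatureMap σ y) =
      Real.exp (-σ ^ 2 * ‖x - y‖ ^ 2) := by
  have hs : Summable fun i => gaussianFeature σ x i * gaussianFeature σ y i := by
    refine (lp.summable_inner (𝕜 := ℝ) (gaussianFeatureMap σ x) (gaussianFeatureMap σ y)).congr
      fun i => ?_
    simp [gaussianFeatureMap, mul_comm]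
  have h : inner ℝ (gaussianFeatureMap σ x) (gaussianFeatureMap σ y) =
      ∑' i, gaussianFeature σ x i * gaussianFeature σ y i := by
    rw [lp.inner_eq_tsum]
    refine tsum_congr fun i => ?_
    simp [gaussianFeatureMap, mul_comm]
  rw [h, hs.tsum_sigma]
  simp_rw [tsum_fintype, sum_gaussianFeature_mul, tsum_mul_left]
  rw [← Real.exp_eq_tsum_pow_div_factorial, ← Real.exp_add, norm_sub_sq_real]
  congr 1
  ring

/-! ### Truncation by degree and the Poisson tail -/

/-- The features of degree less than `N`. -/
def featuresBelow (d N : ℕ) : Finset (Σ k, Sym (Fin d) k) :=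
  (Finset.range N).sigma fun _ => Finset.univ

theorem card_featuresBelow (d n : ℕ) : (featuresBelow d (n + 1)).card = (n + d).choose d := by
  rw [featuresBelow, Finset.card_sigma, ← Nat.sum_range_multichoose]
  refine Finset.sum_congr rfl fun k _ => ?_
  rw [Finset.card_univ, Sym.card_sym_eq_multichoose, Fintype.card_fin]

/-- Chernoff bound for the part of the feature map of degree at least `N`. -/
theorem tsum_gaussianFeature_sq_compl_le {d : ℕ} (σ : ℝ) {x : EuclideanSpace ℝ (Fin d)}
    (hx : ‖x‖ ≤ 1) {N : ℕ} {M r : ℝ} (hr : 1 ≤ r) (hM : M ≤ N) :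
    ∑' i : {i // i ∉ featuresBelow d N}, gaussianFeature σ x i ^ 2 ≤
      r ^ (-M) * Real.exp (2 * σ ^ 2 * (r - 1)) := by
  set b := 2 * σ ^ 2 * ‖x‖ ^ 2 with hb
  have hb0 : 0 ≤ b := by positivity
  have hsum : Summable fun i : Σ k, Sym (Fin d) k => r ^ i.1 * gaussianFeature σ x i ^ 2 := by
    refine (summable_sigma_of_nonneg fun i => by positivity).2 ⟨fun k => Summable.of_finite, ?_⟩
    simp_rw [tsum_fintype, ← Finset.mul_sum, sum_gaussianFeature_sq]
    refine ((Real.summable_pow_div_factorial (r * b)).mul_left (Real.exp (-b))).congr fun k => ?_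
    rw [mul_pow]; ring
  -- The exponential moment of a Poisson variable with mean `b`.
  have htsum : ∑' i : Σ k, Sym (Fin d) k, r ^ i.1 * gaussianFeature σ x i ^ 2 =
      Real.exp (b * (r - 1)) := by
    rw [hsum.tsum_sigma]
    simp_rw [tsum_fintype, ← Finset.mul_sum, sum_gaussianFeature_sq, ← hb]
    have h : ∀ k : ℕ, r ^ k * (Real.exp (-b) * (b ^ k / k.factorial)) =
        Real.exp (-b) * ((r * b) ^ k / k.factorial) := fun k => by rw [mul_pow]; ring
    simp_rw [h]
    rw [tsum_mul_left, ← Real.exp_eq_tsum_pow_div_factorial, ← Real.exp_add]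
    congr 1; ring
  have hr0 : 0 < r := by linarith
  -- Markov's inequality termwise: `r ^ (k - M) ≥ 1` for degrees `k ≥ N ≥ M`.
  have hN : ∀ i : {i // i ∉ featuresBelow d N}, gaussianFeature σ x i ^ 2 ≤
      r ^ (-M) * (r ^ i.1.1 * gaussianFeature σ x i ^ 2) := fun i => by
    have hi : N ≤ i.1.1 := by simpa [featuresBelow] using i.2
    rw [← mul_assoc, ← Real.rpow_natCast r, ← Real.rpow_add hr0]
    refine le_mul_of_one_le_left (sq_nonneg _) (Real.one_le_rpow hr ?_)
    have : (N : ℝ) ≤ i.1.1 := by exact_mod_cast hi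
    linarith
  calc _ ≤ ∑' i : {i // i ∉ featuresBelow d N}, r ^ (-M) * (r ^ i.1.1 * gaussianFeature σ x i ^ 2) :=
        ((summable_gaussianFeature_sq σ x).subtype _).tsum_le_tsum hN
          ((hsum.subtype _).mul_left _)
    _ = r ^ (-M) * ∑' i : {i // i ∉ featuresBelow d N}, (r ^ i.1.1 * gaussianFeature σ x i ^ 2) :=
        tsum_mul_left
    _ ≤ r ^ (-M) * ∑' i : Σ k, Sym (Fin d) k, r ^ i.1 * gaussianFeature σ x i ^ 2 := by
        gcongr
        exact hsum.tsum_subtype_le _ {i | i ∉ featuresBelow d N} fun i => by positivity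
    _ ≤ _ := by
        rw [htsum]
        gcongr
        rw [hb]
        nlinarith [mul_nonneg (sq_nonneg σ) (by nlinarith [norm_nonneg x] : 0 ≤ 1 - ‖x‖ ^ 2)]

/-! ### Scalar estimates -/

/-- Factor by factor, `n + d - j ≤ t s + (d - j) ≤ s (t + d - j)`, since `s ≥ 1` and `j < d`. -/
theorem natCast_choose_le_ringChoose_mul_pow {n d : ℕ} {t s : ℝ} (hs : 1 ≤ s)
    (hn : n ≤ t * s) : ((n + d).choose d : ℝ) ≤ Ring.choose (t + d) d * s ^ d := by
  have hprod : ∀ a : ℝ, Ring.choose a d = (d.factorial : ℝ)⁻¹ * ∏ j ∈ Finset.range d, (a - j) :=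
    fun a => by
      rw [Ring.choose_eq_smul, smul_eq_mul, ← descPochhammer_eval_eq_prod_range,
        ← Polynomial.aeval_eq_smeval, Polynomial.aeval_def, Polynomial.eval₂_eq_eval_map,
        descPochhammer_map]
  rw [← Ring.choose_natCast, hprod, hprod, mul_assoc]
  gcongr
  rw [← Finset.card_range d, ← Finset.prod_const, Finset.card_range, ← Finset.prod_mul_distrib]
  refine Finset.prod_le_prod (fun j hj => ?_) fun j hj => ?_ <;>
  · have hj' : (j : ℝ) ≤ d := by exact_mod_cast (Finset.mem_range.1 hj).le
    have hn0 : (0 : ℝ) ≤ n := by positivity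
    push_cast
    nlinarith [mul_nonneg (sub_nonneg.2 hs) (sub_nonneg.2 hj')]

/-- With `s = σ²`, the base is the Chernoff optimum `r = M / (2s)`. The bound `log y ≥ 1 - 1/y` at
`y = (1+s)/(s log L)` gives `M log r ≥ M + 2L`, while `2s(r - 1) = M - 2s`. -/
theorem rpow_neg_mul_exp_le {L s : ℝ} (hL : 1 < L) (hs : 0 < s) :
    ((1 + s) * L / (s * Real.log L)) ^ (-(2 * (1 + s) * L / Real.log L)) *
      Real.exp (2 * s * ((1 + s) * L / (s * Real.log L) - 1)) ≤ Real.exp (-(2 * L)) := by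
  have hu : 0 < Real.log L := Real.log_pos hL
  set u := Real.log L with hu_def
  have hL0 : 0 < L := by linarith
  have hr : 0 < (1 + s) * L / (s * u) := by positivity
  rw [Real.rpow_def_of_pos hr, ← Real.exp_add]
  refine Real.exp_le_exp.2 ?_
  have hq : 0 < (1 + s) / (s * u) := by positivity
  have hlog : Real.log ((1 + s) * L / (s * u)) = Real.log ((1 + s) / (s * u)) + u := by
    rw [hu_def, ← Real.log_mul hq.ne' hL0.ne']
    congr 1; ring
  have h1 : 1 - s * u / (1 + s) ≤ Real.log ((1 + s) / (s * u)) := by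
    simpa using Real.one_sub_inv_le_log_of_pos hq
  have hM : 0 < 2 * (1 + s) * L / u := by positivity
  have h2 : 2 * (1 + s) * L / u * (1 - s * u / (1 + s) + u) = 2 * L + 2 * (1 + s) * L / u := by
    field_simp; ring
  have h3 : 2 * s * ((1 + s) * L / (s * u) - 1) = 2 * (1 + s) * L / u - 2 * s := by
    field_simp
  rw [h3, hlog]
  nlinarith [mul_le_mul_of_nonneg_left h1 hM.le]

theorem Real.exp_one_mul_log_le {L : ℝ} (hL : 0 < L) : Real.exp 1 * Real.log L ≤ L := by
  have h := Real.add_one_le_exp (Real.log L - 1)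
  rw [Real.exp_sub, Real.exp_log hL, le_div_iff₀ (Real.exp_pos 1)] at h
  linarith

/-! ### Approximation by finitely many features -/

theorem lp.sum_sq_le_norm_sq {ι : Type*} (w : lp (fun _ : ι => ℝ) 2) (S : Finset ι) :
    ∑ i ∈ S, w i ^ 2 ≤ ‖w‖ ^ 2 := by
  simpa using lp.sum_rpow_le_norm_rpow (p := 2) (by norm_num) w S

/-- Cauchy–Schwarz against `φ` with its coordinates in `S` removed. -/
theorem lp.abs_inner_sub_sum_le {ι : Type*} (w φ : lp (fun _ : ι => ℝ) 2) (S : Finset ι) :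
    |inner ℝ w φ - ∑ i ∈ S, w i * φ i| ≤ ‖w‖ * √(∑' i : {i // i ∉ S}, φ i ^ 2) := by
  classical
  have h1 : inner ℝ w φ - ∑ i ∈ S, w i * φ i =
      inner ℝ w (φ - ∑ i ∈ S, lp.single 2 i (φ i)) := by
    rw [inner_sub_right, inner_sum]
    congr 1
    refine Finset.sum_congr rfl fun i _ => ?_
    rw [lp.inner_single_right]
    simp [mul_comm]
  have hsum : Summable fun i => φ i ^ 2 := by
    simpa using (lp.memℓp φ).summable (by norm_num)
  have h2 : ‖φ - ∑ i ∈ S, lp.single 2 i (φ i)‖ ^ 2 = ∑' i : {i // i ∉ S}, φ i ^ 2 := by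
    have h3 := lp.norm_sub_norm_compl_sub_single (p := 2) (by norm_num) φ S
    have h4 := lp.norm_rpow_eq_tsum (p := 2) (by norm_num) φ
    have h5 := hsum.sum_add_tsum_subtype_compl S
    simp at h3 h4
    linarith
  rw [h1, ← h2, Real.sqrt_sq (norm_nonneg _)]
  exact abs_real_inner_le_norm _ _

theorem norm_gaussianFeatureMap {d : ℕ} (σ : ℝ) (x : EuclideanSpace ℝ (Fin d)) :
    ‖gaussianFeatureMap σ x‖ = 1 := by
  have h := inner_gaussianFeatureMap σ x x
  rw [real_inner_self_eq_norm_sq] at h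
  exact (sq_eq_sq₀ (norm_nonneg _) zero_le_one).1 (by simpa using h)

/-- Cauchy–Schwarz with `‖Φ x‖ = 1`; this makes the synthesis map from coefficients to functions
nonexpansive. -/
theorem abs_sum_mul_gaussianFeature_le {d : ℕ} (σ : ℝ) (x : EuclideanSpace ℝ (Fin d))
    {S : Finset (Σ k, Sym (Fin d) k)} (g : EuclideanSpace ℝ S) :
    |∑ i : S, g i * gaussianFeature σ x i| ≤ ‖g‖ := by
  let φ : EuclideanSpace ℝ S := WithLp.toLp 2 fun i : S => gaussianFeature σ x i
  have hφ : ‖φ‖ ≤ 1 := by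
    have h := lp.sum_sq_le_norm_sq (gaussianFeatureMap σ x) S
    rw [norm_gaussianFeatureMap, ← Finset.sum_coe_sort] at h
    rw [EuclideanSpace.norm_eq, Real.sqrt_le_one]
    simpa [φ, gaussianFeatureMap] using h
  have h : inner ℝ g φ = ∑ i : S, g i * gaussianFeature σ x i := by
    simp [PiLp.inner_apply, φ, mul_comm]
  rw [← h]
  exact (abs_real_inner_le_norm _ _).trans (mul_le_of_le_one_right (norm_nonneg _) hφ)

theorem memℓp_sum_mul_gaussianFeature {d : ℕ} (σ : ℝ) (X : Set (EuclideanSpace ℝ (Fin d)))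
    {S : Finset (Σ k, Sym (Fin d) k)} (g : EuclideanSpace ℝ S) :
    Memℓp (fun x : X => ∑ i : S, g i * gaussianFeature σ (x : EuclideanSpace ℝ (Fin d)) i) ∞ := by
  refine memℓp_infty ⟨‖g‖, Set.forall_mem_range.2 fun x => ?_⟩
  rw [Real.norm_eq_abs]
  exact abs_sum_mul_gaussianFeature_le σ (x : EuclideanSpace ℝ (Fin d)) g

/-- The bounded function with coefficients `g` with respect to finitely many Gaussian features. -/
noncomputable def gaussianFeatureSum {d : ℕ} (σ : ℝ) (X : Set (EuclideanSpace ℝ (Fin d)))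
    {S : Finset (Σ k, Sym (Fin d) k)} (g : EuclideanSpace ℝ S) : lp (fun _ : X => ℝ) ∞ :=
  ⟨fun x => ∑ i : S, g i * gaussianFeature σ (x : EuclideanSpace ℝ (Fin d)) i,
    memℓp_sum_mul_gaussianFeature σ X g⟩

theorem norm_gaussianFeatureSum_sub_le {d : ℕ} (σ : ℝ) (X : Set (EuclideanSpace ℝ (Fin d)))
    {S : Finset (Σ k, Sym (Fin d) k)} (g g' : EuclideanSpace ℝ S) :
    ‖gaussianFeatureSum σ X g - gaussianFeatureSum σ X g'‖ ≤ ‖g - g'‖ := by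
  refine lp.norm_le_of_forall_le (norm_nonneg _) fun x => ?_
  have h := abs_sum_mul_gaussianFeature_le σ (x : EuclideanSpace ℝ (Fin d)) (g - g')
  simp only [PiLp.sub_apply, sub_mul, Finset.sum_sub_distrib] at h
  exact h

theorem exists_gaussianFeatureSum_approx {d : ℕ} (σ : ℝ) (X : Set (EuclideanSpace ℝ (Fin d)))
    (S : Finset (Σ k, Sym (Fin d) k)) {δ : ℝ} (hδ : 0 ≤ δ)
    (htail : ∀ x ∈ X, ∑' i : {i // i ∉ S}, gaussianFeature σ x i ^ 2 ≤ δ ^ 2)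
    (f : GaussianRKHS σ X) (hf : ‖f‖ ≤ 1) :
    ∃ g : EuclideanSpace ℝ S, ‖g‖ ≤ 1 ∧
      ‖gaussianEmbedding σ X f - gaussianFeatureSum σ X g‖ ≤ δ := by
  obtain ⟨w, hw, hfw⟩ := RKHS.exists_inner_eq_apply
    (fun x : X => gaussianFeatureMap σ (x : EuclideanSpace ℝ (Fin d))) (fun x y => by
      rw [inner_gaussianFeatureMap, RKHS.OfKernel.kernel_ofKernel]
      simp [gaussianKernel]) f
  have hw1 : ‖w‖ ≤ 1 := hw.trans hf
  refine ⟨WithLp.toLp 2 fun i : S => w i, ?_, lp.norm_le_of_forall_le hδ fun x => ?_⟩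
  · have h := lp.sum_sq_le_norm_sq w S
    rw [← Finset.sum_coe_sort] at h
    rw [EuclideanSpace.norm_eq, Real.sqrt_le_one]
    simpa using h.trans (pow_le_one₀ (norm_nonneg _) hw1)
  · have h := lp.abs_inner_sub_sum_le w (gaussianFeatureMap σ (x : EuclideanSpace ℝ (Fin d))) S
    rw [← hfw, ← Finset.sum_coe_sort] at h
    refine (le_of_eq ?_).trans (h.trans ((mul_le_of_le_one_left (Real.sqrt_nonneg _) hw1).trans
      (Real.sqrt_le_iff.2 ⟨hδ, htail x x.2⟩)))
    rfl

/-! ### Choice of parameters and conclusion -/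

theorem theorem1 (d : ℕ) (hd : 1 ≤ d) (σ : ℝ) (hσ : 0 < σ) (ε : ℝ) (hε : 0 < ε) (hε1 : ε ≤ 1) :
    logCoveringNumber ε
        (gaussianEmbedding σ (Metric.closedBall (0 : EuclideanSpace ℝ (Fin d)) 1)) ≤
      ((Ring.choose (2 * Real.exp 1 * (1 + σ ^ 2) + (d : ℝ)) d * Real.exp (-(d : ℝ)) *
        (Real.log (4 / ε) ^ (d + 1) / Real.log (Real.log (4 / ε)) ^ d) : ℝ) : EReal) := by
  set L := Real.log (4 / ε) with hL_def
  have h4 : 4 ≤ 4 / ε := by rw [le_div_iff₀ hε]; linarith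
  have hL : 1 < L := by
    rw [hL_def, Real.lt_log_iff_exp_lt (by positivity)]
    linarith [Real.exp_one_lt_d9]
  have hL0 : 0 < L := by linarith
  have hu : 0 < Real.log L := Real.log_pos hL
  have huL := Real.exp_one_mul_log_le hL0
  set u := Real.log L with hu_def
  have hs : 0 < σ ^ 2 := by positivity
  set M := 2 * (1 + σ ^ 2) * L / u with hM_def
  have hM : 0 ≤ M := by positivity
  set r := (1 + σ ^ 2) * L / (σ ^ 2 * u) with hr_def
  have huL' : u ≤ L := by nlinarith [Real.add_one_le_exp 1]
  have hr : 1 ≤ r := by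
    rw [hr_def, le_div_iff₀ (by positivity)]
    nlinarith
  have htail : ∀ x ∈ Metric.closedBall (0 : EuclideanSpace ℝ (Fin d)) 1,
      ∑' i : {i // i ∉ featuresBelow d (⌊M⌋₊ + 1)}, gaussianFeature σ x i ^ 2 ≤ (ε / 4) ^ 2 := by
    intro x hx
    refine (tsum_gaussianFeature_sq_compl_le σ (by simpa using hx) hr
      (by exact_mod_cast (Nat.lt_floor_add_one M).le)).trans
      ((rpow_neg_mul_exp_le hL hs).trans_eq ?_)
    rw [hL_def, ← inv_div 4 ε, ← Real.exp_log (by positivity : 0 < 4 / ε), Real.log_exp,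
      ← Real.exp_neg, ← Real.exp_nat_mul]
    congr 1; push_cast; ring
  -- Truncation uses `ε/4`, leaving `3ε/4` for the net; then `1 + 2/η = (ε + 8/3)/ε ≤ 4/ε` because
  -- `ε ≤ 1`.
  have hη : 0 < 3 * ε / 4 := by positivity
  have hcov := logCoveringNumber_le_of_approx hη (gaussianEmbedding σ _) _
    (norm_gaussianFeatureSum_sub_le σ _)
    (exists_gaussianFeatureSum_approx σ _ _ (by positivity) htail)
  rw [show ε / 4 + 3 * ε / 4 = ε by ring] at hcov
  refine hcov.trans (EReal.coe_le_coe_iff.2 ?_)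
  rw [finrank_euclideanSpace, Fintype.card_coe, card_featuresBelow]
  have hlog : Real.log (1 + 2 / (3 * ε / 4)) ≤ L := by
    refine Real.log_le_log (by positivity) ?_
    have : 1 + 2 / (3 * ε / 4) = (ε + 8 / 3) / ε := by field_simp; ring
    rw [this]
    gcongr
    linarith
  have hlog0 : 0 ≤ Real.log (1 + 2 / (3 * ε / 4)) := by
    refine Real.log_nonneg ?_
    have : 0 ≤ 2 / (3 * ε / 4) := by positivity
    linarith
  -- Here `t * s = M`, and `s ≥ 1` is the inequality `e log L ≤ L`; the factor `s ^ d` produces `exp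
  -- (-d)`.
  have hchoose := natCast_choose_le_ringChoose_mul_pow (n := ⌊M⌋₊) (d := d)
    (t := 2 * Real.exp 1 * (1 + σ ^ 2)) (s := L / (Real.exp 1 * u))
    (by rw [le_div_iff₀ (by positivity)]; linarith)
    ((Nat.floor_le hM).trans_eq (by rw [hM_def]; field_simp))
  calc _ ≤ (Ring.choose (2 * Real.exp 1 * (1 + σ ^ 2) + (d : ℝ)) d *
        (L / (Real.exp 1 * u)) ^ d) * L := by
        refine mul_le_mul hchoose hlog hlog0 (le_trans (by positivity) hchoose)
    _ = _ := by
        rw [div_pow, mul_pow, ← Real.exp_nat_mul, mul_one, Real.exp_neg]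
        field_simp
        ring
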